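/- Let $\widetilde G$ be the piecewise $PSL_2(\mathbb Z)$ group: the group of homeomorphisms of $\mathbb R\cup\{\infty\}$ that fix $\infty$ and that are piecewise in $PSL_2(\mathbb Z)$ (acting by $x\mapsto\frac{ax+b}{cx+d}$) with finitely many pieces; its elements are regarded as homeomorphisms of $\mathbb R$. For $h\in\widetilde G$ let $\operatorname{supp}(h)=\{x\in\mathbb R: h(x)\ne x\}$, and let $Br(h)$ be the number of break points of $h$, i.e. of points of $\mathbb R$ near which $h$ is not given by a single element of $PSL_2(\mathbb Z)$. Let $P_{\mathbb Z}\subset\mathbb R$ be the set of fixed points of hyperbolic elements ($|\operatorname{tr}|>2$) of $PSL_2(\mathbb Z)$. Let $H$ be a subgroup of $\widetilde G$. Assume that there are $f,g\in H$ and real numbers $b<c$ such that $g(b)=b$, $f(c)=c$, $(b,c]\subset\operatorname{supp}(g)$ and $[b,c)\subset\operatorname{supp}(f)$. Assume also that there are $s\in P_{\mathbb Z}\cup\mathbb Q$ with $s\le b$ and $\varepsilon_s>0$ such that $f^n(s)\in[b,c]$ for some $n\in\mathbb Z$, and such that $g(s-\varepsilon)=s-\varepsilon$ and $g(s+\varepsilon)\neq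 s+\varepsilon$ for every $0<\varepsilon\le\varepsilon_s$. Then for every probability measure $\mu$ on the (countable, discrete) group $H$ with finite first break moment, $\mathbb E_\mu[Br]=\sum_{h\in H}\mu(h)\,Br(h)<\infty$, whose support $\{h\in H:\mu(h)>0\}$ generates $H$ as a semigroup, the Poisson boundary of $(H,\mu)$ is non-trivial. Here the Poisson boundary is the quotient of $(H^{\mathbb N},P)$ by the measurable hull of the relation identifying two trajectories that coincide after some time up to a time shift, where $P$ is the law of the walk $x_0=1$, $x_{n+1}=y_nx_n$ with $y_0,y_1,\dots$ independent of law $\mu$. Non-trivial means that some measurable set of trajectories that is a union of equivalence classes has $P$-probability strictly between $0$ and $1$. -/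

import Mathlib

open Set Filter Topology MeasureTheory
open scoped OnePoint MatrixGroups

noncomputable section

/-- On the set `I` of real numbers the map `g` coincides with the
projective transformation of `ℝ ∪ {∞}` given by the integer matrix `A`, that is with
`x ↦ (a x + b) / (c x + d)`. In particular `A` sends no point of `I` to `∞`. -/
def AgreesOn (g : ℝ ≃ₜ ℝ) (A : SL(2, ℤ)) (I : Set ℝ) : Prop :=
  ∀ x ∈ I, ((g x : ℝ) : OnePoint ℝ) =
    (Matrix.SpecialLinearGroup.mapGL ℝ A) • ((x : ℝ) : OnePoint ℝ)

/-- `g` is piecewise in `PSL₂(ℤ)` with finitely many pieces: after removing a finite set `F` of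
points, `g` is given by one integer projective transformation on each interval that is left. -/
def IsPiecewisePSL2Z (g : ℝ ≃ₜ ℝ) : Prop :=
  ∃ F : Set ℝ, F.Finite ∧
    ∀ I : Set ℝ, IsPreconnected I → Disjoint I F → ∃ A : SL(2, ℤ), AgreesOn g A I

/-- The piecewise `PSL₂(ℤ)` group: homeomorphisms of the projective line `ℝ ∪ {∞}` that fix `∞`
(that is, homeomorphisms of `ℝ`) and are piecewise in `PSL₂(ℤ)` with finitely many pieces. -/
def piecewisePSL2Z : Subgroup (ℝ ≃ₜ ℝ) where
  carrier := {g | IsPiecewisePSL2Z g}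
  one_mem' := by
    refine ⟨∅, finite_empty, fun I _ _ => ⟨1, fun x _ => ?_⟩⟩
    simp
  mul_mem' := by
    rintro f g ⟨F, hF, hf⟩ ⟨K, hK, hg⟩
    refine ⟨K ∪ g ⁻¹' F, hK.union (hF.preimage g.injective.injOn), fun I hI hd => ?_⟩
    rw [disjoint_union_right] at hd
    obtain ⟨B, hB⟩ := hg I hI hd.1
    obtain ⟨A, hA⟩ := hf (g '' I) (hI.image g g.continuous.continuousOn) (by
      rw [Set.disjoint_left]
      rintro _ ⟨x, hx, rfl⟩ hxF
      exact Set.disjoint_left.1 hd.2 hx hxF)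
    refine ⟨A * B, fun x hx => ?_⟩
    rw [Homeomorph.mul_apply, hA (g x) (mem_image_of_mem g hx), hB x hx, map_mul, mul_smul]
  inv_mem' := by
    rintro g ⟨F, hF, hg⟩
    refine ⟨g '' F, hF.image g, fun I hI hd => ?_⟩
    obtain ⟨A, hA⟩ := hg (g.symm '' I) (hI.image _ g.symm.continuous.continuousOn) (by
      rw [Set.disjoint_left]
      rintro _ ⟨x, hx, rfl⟩ hxF
      exact Set.disjoint_left.1 hd hx ⟨g.symm x, hxF, g.apply_symm_apply x⟩)
    refine ⟨A⁻¹, fun x hx => ?_⟩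
    have h := hA (g.symm x) (mem_image_of_mem _ hx)
    rw [g.apply_symm_apply] at h
    rw [Homeomorph.inv_apply, h, map_inv, inv_smul_smul]

/-- The set `P_ℤ ⊆ ℝ` of fixed points of hyperbolic elements of `PSL₂(ℤ)`, those with `|tr| > 2`
(the point `∞` is not a fixed point of any such element). -/
def hyperbolicFixedPoints : Set ℝ :=
  {x | ∃ A : SL(2, ℤ), 2 < |A.val.trace| ∧
    (Matrix.SpecialLinearGroup.mapGL ℝ A) • (x : OnePoint ℝ) = (x : OnePoint ℝ)}

/-- The support `{x | g x ≠ x}` of a homeomorphism of the line. -/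
def homeoSupp (g : ℝ ≃ₜ ℝ) : Set ℝ := {x | g x ≠ x}

/-- The break points of `g`: the ends of the (maximal) pieces of its piecewise definition, that is
the points around which `g` is not given by a single element of `PSL₂(ℤ)`. -/
def breakPoints (g : ℝ ≃ₜ ℝ) : Set ℝ :=
  {x | ¬ ∃ U ∈ 𝓝 x, ∃ A : SL(2, ℤ), AgreesOn g A U}

/-- The number `Br g` of break points. -/
def numBreaks (g : ℝ ≃ₜ ℝ) : ENNReal := ((breakPoints g).encard : ENNReal)

section RandomWalk

/-- The trajectory `(x₀, x₁, …)` of the walk by left multiplication with increments `y`: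
`x₀ = 1` and `xₙ₊₁ = yₙ xₙ`. -/
def walkTrajectory {G : Type*} [Group G] (y : ℕ → G) : ℕ → G
  | 0 => 1
  | n + 1 => y n * walkTrajectory y n

/-- The law on the trajectory space `G^ℕ` of the random walk by left multiplication whose increments
are independent with law `μ` (for a countable discrete group `G`). -/
def walkLaw {G : Type*} [Group G] [MeasurableSpace G] (μ : Measure G) : Measure (ℕ → G) :=
  (Measure.infinitePi fun _ : ℕ => μ).map walkTrajectory

/-- Two trajectories are equivalent if they coincide after a certain time, up to a time shift. -/
def trajectorySetoid (G : Type*) : Setoid (ℕ → G) where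
  r x y := ∃ m n : ℕ, ∀ i : ℕ, x (m + i) = y (n + i)
  iseqv :=
    { refl := fun _ => ⟨0, 0, fun _ => rfl⟩
      symm := fun ⟨m, n, h⟩ => ⟨n, m, fun i => (h i).symm⟩
      trans := by
        rintro x y z ⟨m, n, h⟩ ⟨p, q, k⟩
        refine ⟨m + p, q + n, fun i => ?_⟩
        have h1 := h (p + i)
        have h2 := k (n + i)
        rw [add_assoc, h1, add_assoc, ← h2]
        congr 1
        omega }

/-- The Poisson boundary as a measurable space: the quotient of the trajectory space. It carries the
quotient σ-algebra, whose members correspond to the measurable unions of equivalence classes of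
trajectories; this is the quotient by the measurable hull of the equivalence relation. -/
abbrev PoissonBoundary (G : Type*) : Type _ := Quotient (trajectorySetoid G)

/-- The measure on the Poisson boundary: the image of the law of the walk. -/
def poissonMeasure {G : Type*} [Group G] [MeasurableSpace G] (μ : Measure G) :
    Measure (PoissonBoundary G) :=
  (walkLaw μ).map (Quotient.mk (trajectorySetoid G))

/-- The Poisson boundary is non-trivial: as a measure space it is not a single point, i.e. it has a
measurable subset that is neither null nor of full measure. -/
def NontrivialPoissonBoundary {G : Type*} [Group G] [MeasurableSpace G] (μ : Measure G) : Prop :=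
  ∃ B : Set (PoissonBoundary G), MeasurableSet B ∧ 0 < poissonMeasure μ B ∧ poissonMeasure μ B < 1

end RandomWalk

end

/-! ### Random walk on a group and its Green function -/

section WalkLaw

/-! Follow the germ of `x_n` at `s`, modulo post-composition by PSL₂(ℤ). The step `x_{n+1} = y_n
x_n` can change this class only if `x_n s` is a break point of `y_n`. If the induced walk `x_n s` is
transient, its Green function is bounded, so the expected number of such times is at most a constant
times `E[Br]`; by Borel–Cantelli the class stabilizes (`ae_eventually_walk_smul_notMem`).

The limit class is shift invariant. Either it gives a non-trivial event, or it is almost surely one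
class `q`. In the second case, prepending a word for `g` shows that the class of `x_n g` also tends
to `q` (`ae_eventually_mul_right_eq`). But `g` is the identity on the left of `s` only, and a
projective map trivial on an interval is trivial, so `x_n` and `x_n g` never have the same class
(`not_germSetoid_mul`).

Transience comes from `f` and `g`: they yield two maps sending `[b, c]` into disjoint parts of
itself, hence a binary tree in the orbit of `s`. A unit flow of finite energy on it bounds point
values by the Dirichlet form, which bounds the Green function
(`tsum_hitProb_self_lt_top_of_pingPong`). -/

/-- Prepend a term to a sequence. -/
def seqCons {G : Type*} (p : G × (ℕ → G)) : ℕ → G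
  | 0 => p.1
  | n + 1 => p.2 n

theorem measurable_seqCons {G : Type*} [MeasurableSpace G] :
    Measurable (seqCons : G × (ℕ → G) → ℕ → G) := by
  refine measurable_pi_lambda _ fun n => ?_
  cases n with
  | zero => exact measurable_fst
  | succ n => exact (measurable_pi_apply n).comp measurable_snd

theorem map_seqCons {G : Type*} [MeasurableSpace G] (μ : Measure G) [IsProbabilityMeasure μ] :
    (μ.prod (Measure.infinitePi fun _ : ℕ => μ)).map seqCons =
      Measure.infinitePi fun _ : ℕ => μ := by
  classical
  refine Measure.eq_infinitePi _ fun s t ht => ?_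
  obtain ⟨N, hN⟩ : ∃ N, s ⊆ Finset.range (N + 1) :=
    ⟨s.sup id, fun i hi => Finset.mem_range.2 (Nat.lt_succ_of_le (Finset.le_sup (f := id) hi))⟩
  -- Padding with `univ` gives a cylinder over an initial segment, whose preimage under `seqCons` is
  -- a product set.
  set t' : ℕ → Set G := fun i => if i ∈ s then t i else univ with ht'
  have hmt' : ∀ i, MeasurableSet (t' i) := fun i => by
    simp only [ht']; split_ifs
    exacts [ht i, MeasurableSet.univ]
  have hpi : Set.pi (s : Set ℕ) t = Set.pi (Finset.range (N + 1) : Set ℕ) t' := by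
    ext y
    simp only [Set.mem_pi, ht', Finset.mem_coe]
    constructor
    · intro h i _
      split_ifs with his
      exacts [h i his, mem_univ _]
    · intro h i his
      simpa [his] using h i (hN his)
  have hprod : ∏ i ∈ s, μ (t i) = ∏ i ∈ Finset.range (N + 1), μ (t' i) := by
    rw [← Finset.prod_subset hN]
    · exact Finset.prod_congr rfl fun i hi => by simp [ht', hi]
    · intro i _ hi
      simp [ht', hi]
  have hpre : seqCons ⁻¹' (Set.pi (Finset.range (N + 1) : Set ℕ) t') =
      t' 0 ×ˢ Set.pi (Finset.range N : Set ℕ) (fun i => t' (i + 1)) := by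
    ext ⟨k, y⟩
    simp only [mem_preimage, Set.mem_pi, Finset.coe_range, mem_Iio, mem_prod]
    constructor
    · intro h
      exact ⟨h 0 (Nat.succ_pos _), fun i hi => h (i + 1) (Nat.succ_lt_succ hi)⟩
    · rintro ⟨h0, h1⟩ i hi
      cases i with
      | zero => exact h0
      | succ i => exact h1 i (Nat.lt_of_succ_lt_succ hi)
  rw [hpi, hprod, Measure.map_apply measurable_seqCons
    (MeasurableSet.pi (Finset.countable_toSet _) fun i _ => hmt' i), hpre, Measure.prod_prod,
    Measure.infinitePi_pi _ (fun i _ => hmt' (i + 1)), Finset.prod_range_succ', mul_comm]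

theorem lintegral_infinitePi_seqCons {G : Type*} [MeasurableSpace G] (μ : Measure G)
    [IsProbabilityMeasure μ] {F : (ℕ → G) → ENNReal} (hF : Measurable F) :
    ∫⁻ y, F y ∂(Measure.infinitePi fun _ : ℕ => μ) =
      ∫⁻ k, ∫⁻ y, F (seqCons (k, y)) ∂(Measure.infinitePi fun _ : ℕ => μ) ∂μ := by
  conv_lhs => rw [← map_seqCons μ]
  rw [lintegral_map hF measurable_seqCons]
  exact lintegral_prod _ (hF.comp measurable_seqCons).aemeasurable

theorem ae_infinitePi_seqCons {G : Type*} [MeasurableSpace G] (μ : Measure G)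
    [IsProbabilityMeasure μ] {p : (ℕ → G) → Prop}
    (hp : ∀ᵐ y ∂(Measure.infinitePi fun _ : ℕ => μ), p y) :
    ∀ᵐ k ∂μ, ∀ᵐ y ∂(Measure.infinitePi fun _ : ℕ => μ), p (seqCons (k, y)) := by
  rw [← map_seqCons μ] at hp
  exact Measure.ae_ae_of_ae_prod (ae_of_ae_map measurable_seqCons.aemeasurable hp)

variable {G : Type*} [Group G]

theorem walkTrajectory_seqCons (k : G) (y : ℕ → G) (n : ℕ) :
    walkTrajectory (seqCons (k, y)) (n + 1) = walkTrajectory y n * k := by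
  induction n with
  | zero => simp [walkTrajectory, seqCons]
  | succ n ih => rw [walkTrajectory, ih, walkTrajectory, mul_assoc]; rfl

variable [MeasurableSpace G] (μ : Measure G) {X : Type*} [MulAction G X]

/-- The probability that at time `n` the induced walk from `s` is at `x`. -/
noncomputable def hitProb (s : X) (n : ℕ) (x : X) : ENNReal :=
  (Measure.infinitePi fun _ : ℕ => μ) {y | walkTrajectory y n • s = x}

theorem hitProb_zero_self [IsProbabilityMeasure μ] (s : X) : hitProb μ s 0 s = 1 := by
  simp [hitProb, walkTrajectory]

theorem hitProb_zero_of_ne {s x : X} (h : x ≠ s) : hitProb μ s 0 x = 0 := by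
  simp [hitProb, walkTrajectory, h.symm]

variable [Countable G] [DiscreteMeasurableSpace G]

theorem measurable_walkTrajectory_apply (n : ℕ) :
    Measurable fun y : ℕ → G => walkTrajectory y n := by
  induction n with
  | zero => exact measurable_const
  | succ n ih => exact (measurable_pi_apply n).mul ih

theorem measurable_walkTrajectory :
    Measurable (walkTrajectory : (ℕ → G) → ℕ → G) :=
  measurable_pi_lambda _ measurable_walkTrajectory_apply

variable [IsProbabilityMeasure μ]

/-- The position at time `n` depends only on the increments before `y n`, so the two are
independent. The induction peels off the first increment. -/
theorem lintegral_increment_walkTrajectory (n : ℕ) (F : G → G → ENNReal) :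
    ∫⁻ y, F (y n) (walkTrajectory y n) ∂(Measure.infinitePi fun _ : ℕ => μ) =
      ∫⁻ h, ∫⁻ y, F h (walkTrajectory y n) ∂(Measure.infinitePi fun _ : ℕ => μ) ∂μ := by
  have hF2 : ∀ F : G → G → ENNReal, Measurable (fun p : G × G => F p.1 p.2) :=
    fun F => Measurable.of_discrete
  have hF1 : ∀ (F : G → G → ENNReal) (n : ℕ),
      Measurable fun y : ℕ → G => F (y n) (walkTrajectory y n) := fun F n =>
    (hF2 F).comp ((measurable_pi_apply n).prodMk (measurable_walkTrajectory_apply n))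
  have hF0 : ∀ (F : G → ENNReal) (n : ℕ),
      Measurable fun y : ℕ → G => F (walkTrajectory y n) := fun F n =>
    (Measurable.of_discrete (f := F)).comp (measurable_walkTrajectory_apply n)
  induction n generalizing F with
  | zero =>
    rw [lintegral_infinitePi_seqCons μ (hF1 F 0)]
    rfl
  | succ n ih =>
    rw [lintegral_infinitePi_seqCons μ (hF1 F (n + 1))]
    simp only [walkTrajectory_seqCons]
    have h1 : ∀ k : G, ∫⁻ y, F (seqCons (k, y) (n + 1)) (walkTrajectory y n * k)
        ∂(Measure.infinitePi fun _ : ℕ => μ) = ∫⁻ h, ∫⁻ y, F h (walkTrajectory y n * k)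
          ∂(Measure.infinitePi fun _ : ℕ => μ) ∂μ := fun k => ih fun a b => F a (b * k)
    simp only [h1]
    rw [lintegral_lintegral_swap Measurable.of_discrete.aemeasurable]
    refine lintegral_congr fun h => ?_
    rw [lintegral_infinitePi_seqCons μ (hF0 (F h) (n + 1))]
    simp only [walkTrajectory_seqCons]

theorem measurableSet_walkTrajectory_apply (n : ℕ) (p : G → Prop) :
    MeasurableSet {y : ℕ → G | p (walkTrajectory y n)} :=
  measurable_walkTrajectory_apply n (MeasurableSet.of_discrete (s := {k | p k}))

theorem measurableSet_increment_walkTrajectory (n : ℕ) (p : G → G → Prop) :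
    MeasurableSet {y : ℕ → G | p (y n) (walkTrajectory y n)} :=
  ((measurable_pi_apply n).prodMk (measurable_walkTrajectory_apply n))
    (MeasurableSet.of_discrete (s := {k : G × G | p k.1 k.2}))

theorem measure_increment_walkTrajectory (n : ℕ) (p : G → G → Prop) :
    (Measure.infinitePi fun _ : ℕ => μ) {y | p (y n) (walkTrajectory y n)} =
      ∫⁻ h, (Measure.infinitePi fun _ : ℕ => μ) {y | p h (walkTrajectory y n)} ∂μ := by
  classical
  have h1 := lintegral_increment_walkTrajectory μ n fun a b => if p a b then 1 else 0
  have h2 : ∀ h, ∫⁻ y, (if p h (walkTrajectory y n) then 1 else 0 : ENNReal)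
      ∂(Measure.infinitePi fun _ : ℕ => μ) =
      (Measure.infinitePi fun _ : ℕ => μ) {y | p h (walkTrajectory y n)} := fun h => by
    rw [← lintegral_indicator_one (measurableSet_walkTrajectory_apply n (p h))]
    rfl
  simp only [h2] at h1
  rw [← h1, ← lintegral_indicator_one (measurableSet_increment_walkTrajectory n p)]
  rfl

theorem hitProb_succ (s : X) (n : ℕ) (x : X) :
    hitProb μ s (n + 1) x = ∫⁻ h, hitProb μ s n (h⁻¹ • x) ∂μ := by
  have := measure_increment_walkTrajectory μ n fun a b => (a * b) • s = x
  refine this.trans (lintegral_congr fun h => ?_)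
  simp only [hitProb, mul_smul, eq_inv_smul_iff]

/-- Maximum principle: away from `s` time 0 contributes nothing, so the sum up to `N + 1` averages
sums up to `N` over the possible previous positions. -/
theorem sum_hitProb_le_tsum_self (s : X) (N : ℕ) (x : X) :
    ∑ n ∈ Finset.range N, hitProb μ s n x ≤ ∑' n, hitProb μ s n s := by
  by_cases hx : x = s
  · subst hx
    exact ENNReal.sum_le_tsum _
  induction N generalizing x with
  | zero => simp
  | succ N ih =>
    rw [Finset.sum_range_succ', hitProb_zero_of_ne μ hx, add_zero]
    simp only [hitProb_succ]
    rw [← lintegral_finsetSum _ fun _ _ => Measurable.of_discrete]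
    calc ∫⁻ h, ∑ n ∈ Finset.range N, hitProb μ s n (h⁻¹ • x) ∂μ
        ≤ ∫⁻ _, ∑' n, hitProb μ s n s ∂μ := by
          refine lintegral_mono fun h => ?_
          by_cases hh : h⁻¹ • x = s
          · rw [hh]; exact ENNReal.sum_le_tsum _
          · exact ih _ hh
      _ = _ := by simp

theorem tsum_hitProb_le_tsum_self (s x : X) :
    ∑' n, hitProb μ s n x ≤ ∑' n, hitProb μ s n s :=
  ENNReal.tsum_le_of_sum_range_le fun N => sum_hitProb_le_tsum_self μ s N x

/-- If the induced walk from `s` is transient, then it almost surely leaves random exceptional sets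
with finite expected cardinality. -/
theorem ae_eventually_walk_smul_notMem (s : X) (htr : ∑' n, hitProb μ s n s < ⊤)
    (B : G → Set X) (hB : ∫⁻ h, ((B h).encard : ENNReal) ∂μ < ⊤) :
    ∀ᵐ y ∂(Measure.infinitePi fun _ : ℕ => μ),
      ∀ᶠ n in atTop, walkTrajectory y n • s ∉ B (y n) := by
  refine ae_eventually_notMem (s := fun n => {y | walkTrajectory y n • s ∈ B (y n)}) ?_
  -- Makes the bound `⊤` when `B h` is infinite.
  have hpos : ∑' n, hitProb μ s n s ≠ 0 := fun h0 => by
    have := ENNReal.le_tsum (f := fun n => hitProb μ s n s) 0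
    rw [h0, hitProb_zero_self] at this
    simp at this
  have key : ∀ h, ∑' n, (Measure.infinitePi fun _ : ℕ => μ) {y | walkTrajectory y n • s ∈ B h} ≤
      (∑' n, hitProb μ s n s) * ((B h).encard : ENNReal) := fun h => by
    by_cases hfin : (B h).Finite
    · have h1 : ∀ n, (Measure.infinitePi fun _ : ℕ => μ) {y | walkTrajectory y n • s ∈ B h} ≤
          ∑ p ∈ hfin.toFinset, hitProb μ s n p := fun n => by
        refine (measure_mono fun y hy => ?_).trans (measure_biUnion_finset_le hfin.toFinset _)
        simpa using hy
      refine (ENNReal.tsum_le_tsum h1).trans ?_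
      rw [Summable.tsum_finsetSum fun _ _ => ENNReal.summable]
      refine (Finset.sum_le_sum fun p _ => tsum_hitProb_le_tsum_self μ s p).trans ?_
      rw [Finset.sum_const, hfin.encard_eq_coe_toFinset_card, nsmul_eq_mul, mul_comm]
      simp
    · rw [Set.Infinite.encard_eq hfin]
      simp [ENNReal.mul_top hpos]
  refine ne_top_of_le_ne_top (b := (∑' n, hitProb μ s n s) * ∫⁻ h, ((B h).encard : ENNReal) ∂μ)
    (ENNReal.mul_ne_top htr.ne hB.ne) ?_
  simp only [fun n => measure_increment_walkTrajectory μ n fun a b => b • s ∈ B a]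
  rw [← lintegral_tsum fun _ => Measurable.of_discrete.aemeasurable,
    ← lintegral_const_mul _ Measurable.of_discrete]
  exact lintegral_mono key

end WalkLaw

/-! ### Transience by an energy estimate in ℓ² -/

section Transience

open scoped InnerProductSpace

variable {G : Type*} [Group G] {X : Type*} [MulAction G X]

theorem memℓp_comp_smul (g : G) {φ : X → ℝ} (h : Memℓp φ 2) : Memℓp (fun x => φ (g • x)) 2 := by
  have h2 : (0 : ℝ) < (2 : ENNReal).toReal := by norm_num
  refine memℓp_gen (E := fun _ : X => ℝ) ?_
  exact (h.summable h2).comp_injective (MulAction.injective g)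

/-- The unitary permutation representation on `ℓ²(X)`. -/
noncomputable def permRep (g : G) :
    lp (fun _ : X => ℝ) 2 →ₗᵢ[ℝ] lp (fun _ : X => ℝ) 2 where
  toFun φ := ⟨fun x => φ (g⁻¹ • x), memℓp_comp_smul g⁻¹ (lp.memℓp φ)⟩
  map_add' φ ψ := rfl
  map_smul' a φ := rfl
  norm_map' φ := by
    have h2 : (0 : ℝ) < (2 : ENNReal).toReal := by norm_num
    rw [lp.norm_eq_tsum_rpow h2, lp.norm_eq_tsum_rpow h2]
    congr 1
    exact (MulAction.toPerm (g⁻¹ : G)).tsum_eq fun x => ‖φ x‖ ^ (2 : ENNReal).toReal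

theorem permRep_apply (g : G) (φ : lp (fun _ : X => ℝ) 2) (x : X) :
    permRep g φ x = φ (g⁻¹ • x) := rfl

theorem permRep_mul (g h : G) (φ : lp (fun _ : X => ℝ) 2) :
    permRep (g * h) φ = permRep g (permRep h φ) := by
  ext x
  simp [permRep_apply, mul_smul]

theorem permRep_inv_permRep (g : G) (φ : lp (fun _ : X => ℝ) 2) :
    permRep g⁻¹ (permRep g φ) = φ := by
  ext x
  simp [permRep_apply]

theorem inner_permRep_right (g : G) (φ ψ : lp (fun _ : X => ℝ) 2) :
    ⟪φ, permRep g ψ⟫_ℝ = ⟪permRep g⁻¹ φ, ψ⟫_ℝ := by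
  rw [← (permRep (X := X) g⁻¹).inner_map_map φ, permRep_inv_permRep]

open Classical in
theorem inner_single_one (φ : lp (fun _ : X => ℝ) 2) (x : X) :
    ⟪φ, lp.single 2 x (1 : ℝ)⟫_ℝ = φ x := by
  rw [lp.inner_single_right]
  simp

/-- Two maps with disjoint images inside `J` move a point of `J` along a binary tree; the resulting
unit flow of finite energy bounds the value at the point by the displacement under both maps. -/
theorem abs_apply_le_of_pingPong (J : Set X) (α β : G) (hα : ∀ x ∈ J, α • x ∈ J)
    (hβ : ∀ x ∈ J, β • x ∈ J) (hd : ∀ x ∈ J, ∀ y ∈ J, α • x ≠ β • y) {p : X} (hp : p ∈ J) :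
    ∃ C : ℝ, 0 ≤ C ∧ ∀ (φ : lp (fun _ : X => ℝ) 2) (D : ℝ), ‖φ - permRep α⁻¹ φ‖ ≤ D →
      ‖φ - permRep β⁻¹ φ‖ ≤ D → |φ p| ≤ C * D := by
  classical
  -- `ψ n` is the uniform distribution on the level-`n` vertices of the tree, the images of `p`
  -- under words of length `n` in `α`, `β`. Disjointness makes the two halves orthogonal, so the
  -- squared norm halves at each level.
  let S : lp (fun _ : X => ℝ) 2 → lp (fun _ : X => ℝ) 2 :=
    fun ψ => (1 / 2 : ℝ) • (permRep α ψ + permRep β ψ)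
  let ψ : ℕ → lp (fun _ : X => ℝ) 2 := fun n => S^[n] (lp.single 2 p (1 : ℝ))
  have hψs : ∀ n, ψ (n + 1) = (1 / 2 : ℝ) • (permRep α (ψ n) + permRep β (ψ n)) := fun n =>
    Function.iterate_succ_apply' S n _
  have hsupp : ∀ n x, ψ n x ≠ 0 → x ∈ J := by
    intro n
    induction n with
    | zero =>
      intro x hx
      by_contra hxJ
      have hxp : x ≠ p := fun h => hxJ (h ▸ hp)
      exact hx (lp.single_apply_ne (E := fun _ : X => ℝ) 2 p (1 : ℝ) hxp)
    | succ n ih =>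
      intro x hx
      have hx' : (1 / 2 : ℝ) * (ψ n (α⁻¹ • x) + ψ n (β⁻¹ • x)) ≠ 0 := by
        rw [hψs] at hx
        exact hx
      by_cases h1 : ψ n (α⁻¹ • x) = 0
      · by_cases h2 : ψ n (β⁻¹ • x) = 0
        · simp [h1, h2] at hx'
        · simpa using hβ _ (ih _ h2)
      · simpa using hα _ (ih _ h1)
  have horth : ∀ n, ⟪permRep α (ψ n), permRep β (ψ n)⟫_ℝ = 0 := by
    intro n
    rw [lp.inner_eq_tsum]
    refine (tsum_congr fun x => ?_).trans tsum_zero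
    rw [permRep_apply, permRep_apply]
    by_cases h1 : ψ n (α⁻¹ • x) = 0
    · simp [h1]
    · by_cases h2 : ψ n (β⁻¹ • x) = 0
      · simp [h2]
      · exact absurd (by simp) (hd _ (hsupp n _ h1) _ (hsupp n _ h2))
  have hnorm : ∀ n, ‖ψ n‖ = √(1 / 2) ^ n := by
    intro n
    induction n with
    | zero =>
      change ‖lp.single (E := fun _ : X => ℝ) 2 p (1 : ℝ)‖ = _
      rw [lp.norm_single (by norm_num)]
      simp
    | succ n ih =>
      have h1 : ‖permRep α (ψ n) + permRep β (ψ n)‖ * ‖permRep α (ψ n) + permRep β (ψ n)‖ =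
          ‖ψ n‖ * ‖ψ n‖ + ‖ψ n‖ * ‖ψ n‖ := by
        rw [norm_add_sq_eq_norm_sq_add_norm_sq_of_inner_eq_zero _ _ (horth n)]
        simp
      rw [hψs, norm_smul, pow_succ, ← ih, ← sq_eq_sq₀ (by positivity) (by positivity), mul_pow,
        mul_pow, Real.sq_sqrt (by norm_num), sq ‖_ + _‖, h1]
      norm_num
      ring
  set r : ℝ := √(1 / 2) with hr
  have hr0 : 0 ≤ r := Real.sqrt_nonneg _
  have hr1 : r < 1 := by
    rw [hr, Real.sqrt_lt' one_pos]
    norm_num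
  refine ⟨(1 - r)⁻¹, inv_nonneg.2 (by linarith), fun φ D hD1 hD2 => ?_⟩
  have hD : 0 ≤ D := (norm_nonneg _).trans hD1
  -- Passing down one level costs at most `D * ‖ψ n‖`; these costs form a geometric series, and the
  -- remainder `‖φ‖ * r ^ N` vanishes.
  have hstep : ∀ n, |⟪φ, ψ n⟫_ℝ| ≤ |⟪φ, ψ (n + 1)⟫_ℝ| + D * r ^ n := by
    intro n
    have h1 : ⟪φ, ψ n⟫_ℝ - ⟪φ, ψ (n + 1)⟫_ℝ =
        (1 / 2) * (⟪φ - permRep α⁻¹ φ, ψ n⟫_ℝ + ⟪φ - permRep β⁻¹ φ, ψ n⟫_ℝ) := by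
      rw [hψs, inner_smul_right, inner_add_right, inner_permRep_right, inner_permRep_right,
        inner_sub_left, inner_sub_left]
      ring
    have h2 := (abs_real_inner_le_norm (φ - permRep α⁻¹ φ) (ψ n)).trans
      (mul_le_mul_of_nonneg_right hD1 (norm_nonneg _))
    have h3 := (abs_real_inner_le_norm (φ - permRep β⁻¹ φ) (ψ n)).trans
      (mul_le_mul_of_nonneg_right hD2 (norm_nonneg _))
    rw [hnorm] at h2 h3
    rw [abs_le] at h2 h3
    have h4 : |⟪φ, ψ n⟫_ℝ - ⟪φ, ψ (n + 1)⟫_ℝ| ≤ D * r ^ n := by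
      rw [h1, abs_le]
      constructor <;> linarith
    have := abs_sub_abs_le_abs_sub ⟪φ, ψ n⟫_ℝ ⟪φ, ψ (n + 1)⟫_ℝ
    linarith
  have hsum : ∀ N, |φ p| ≤ ‖φ‖ * r ^ N + D * (1 - r)⁻¹ := by
    intro N
    have h1 : |φ p| ≤ |⟪φ, ψ N⟫_ℝ| + D * ∑ n ∈ Finset.range N, r ^ n := by
      induction N with
      | zero => simp [ψ, inner_single_one]
      | succ N ih =>
        rw [Finset.sum_range_succ, mul_add]
        linarith [hstep N]
    have h2 := abs_real_inner_le_norm φ (ψ N)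
    rw [hnorm] at h2
    have h3 : ∑ n ∈ Finset.range N, r ^ n ≤ (1 - r)⁻¹ := by
      rw [← tsum_geometric_of_lt_one hr0 hr1]
      exact (summable_geometric_of_lt_one hr0 hr1).sum_le_tsum _ fun _ _ => by positivity
    have h4 := mul_le_mul_of_nonneg_left h3 hD
    linarith
  have hlim : Tendsto (fun N => ‖φ‖ * r ^ N + D * (1 - r)⁻¹) atTop
      (𝓝 (‖φ‖ * 0 + D * (1 - r)⁻¹)) :=
    ((tendsto_pow_atTop_nhds_zero_of_lt_one hr0 hr1).const_mul _).add_const _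
  have := ge_of_tendsto' hlim hsum
  rw [mul_zero, zero_add] at this
  linarith

variable [Countable G] [MeasurableSpace G] [DiscreteMeasurableSpace G]
variable (μ : Measure G) [IsProbabilityMeasure μ]

/-- The transition operator of the induced walk on `ℓ²(X)`. -/
noncomputable def transitionOp (φ : lp (fun _ : X => ℝ) 2) : lp (fun _ : X => ℝ) 2 :=
  ∫ h : G, permRep h φ ∂μ

theorem integrable_permRep (φ : lp (fun _ : X => ℝ) 2) :
    Integrable (fun h : G => permRep h φ) μ :=
  Integrable.of_bound (AEStronglyMeasurable.of_discrete) ‖φ‖ (by simp)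

theorem inner_transitionOp (φ ψ : lp (fun _ : X => ℝ) 2) :
    ⟪ψ, transitionOp μ φ⟫_ℝ = ∫ h : G, ⟪ψ, permRep h φ⟫_ℝ ∂μ :=
  (integral_inner (integrable_permRep μ φ) ψ).symm

theorem transitionOp_apply (φ : lp (fun _ : X => ℝ) 2) (x : X) :
    transitionOp μ φ x = ∫ h : G, φ (h⁻¹ • x) ∂μ := by
  classical
  rw [← inner_single_one, real_inner_comm, inner_transitionOp]
  refine integral_congr_ae (ae_of_all _ fun h => ?_)
  simp only
  rw [real_inner_comm, inner_single_one, permRep_apply]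

theorem transitionOp_add (φ ψ : lp (fun _ : X => ℝ) 2) :
    transitionOp μ (φ + ψ) = transitionOp μ φ + transitionOp μ ψ := by
  simp only [transitionOp, map_add]
  exact integral_add (integrable_permRep μ φ) (integrable_permRep μ ψ)

/-- The Dirichlet form of the induced walk. -/
noncomputable def dirichletForm (φ : lp (fun _ : X => ℝ) 2) : ℝ :=
  ⟪φ, φ - transitionOp μ φ⟫_ℝ

/-- Each `permRep h` is an isometry, so expanding the square suffices; symmetry of `μ` plays no
role. -/
theorem two_mul_dirichletForm (φ : lp (fun _ : X => ℝ) 2) :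
    2 * dirichletForm μ φ = ∫ h : G, ‖φ - permRep h φ‖ ^ 2 ∂μ := by
  have h1 : ∀ h : G, ‖φ - permRep h φ‖ ^ 2 = 2 * ⟪φ, φ⟫_ℝ - 2 * ⟪φ, permRep h φ⟫_ℝ := fun h => by
    rw [norm_sub_sq_real, LinearIsometry.norm_map, real_inner_self_eq_norm_sq]
    ring
  have h2 : ∫ h : G, 2 * ⟪φ, permRep h φ⟫_ℝ ∂μ = 2 * ⟪φ, transitionOp μ φ⟫_ℝ := by
    rw [inner_transitionOp]
    exact integral_const_mul 2 _
  have h3 : ∫ _ : G, 2 * ⟪φ, φ⟫_ℝ ∂μ = 2 * ⟪φ, φ⟫_ℝ := by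
    rw [integral_const, probReal_univ, one_smul]
  simp only [h1]
  rw [integral_sub (integrable_const _) (((integrable_permRep μ φ).const_inner φ).const_mul 2), h2,
    h3, dirichletForm, inner_sub_right]
  ring

theorem norm_sub_permRep_le_of_pos {h : G} (hh : 0 < μ {h}) :
    ∃ C : ℝ, 0 ≤ C ∧ ∀ φ : lp (fun _ : X => ℝ) 2,
      ‖φ - permRep h φ‖ ≤ C * √(dirichletForm μ φ) := by
  have hpos : 0 < μ.real {h} := ENNReal.toReal_pos hh.ne' (measure_ne_top _ _)
  refine ⟨√(2 / μ.real {h}), Real.sqrt_nonneg _, fun φ => ?_⟩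
  rw [← Real.sqrt_mul (by positivity)]
  refine Real.le_sqrt_of_sq_le ?_
  rw [div_mul_eq_mul_div, le_div_iff₀ hpos, two_mul_dirichletForm]
  have hint : Integrable (fun h : G => ‖φ - permRep h φ‖ ^ 2) μ := by
    refine Integrable.of_bound AEStronglyMeasurable.of_discrete ((‖φ‖ + ‖φ‖) ^ 2)
      (ae_of_all _ fun k => ?_)
    rw [Real.norm_of_nonneg (by positivity)]
    gcongr
    exact (norm_sub_le _ _).trans (by simp)
  calc ‖φ - permRep h φ‖ ^ 2 * μ.real {h} = ∫ k in {h}, ‖φ - permRep k φ‖ ^ 2 ∂μ := by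
        rw [integral_singleton, smul_eq_mul, mul_comm]
    _ ≤ _ := setIntegral_le_integral hint (ae_of_all _ fun _ => by positivity)

/-- Displacement is subadditive along products, so the bound passes from the atoms of `μ` to the
semigroup they generate. -/
theorem norm_sub_permRep_le (hgen : Subsemigroup.closure {h : G | 0 < μ {h}} = ⊤) (h : G) :
    ∃ C : ℝ, 0 ≤ C ∧ ∀ φ : lp (fun _ : X => ℝ) 2,
      ‖φ - permRep h φ‖ ≤ C * √(dirichletForm μ φ) := by
  have hmem : h ∈ Subsemigroup.closure {h : G | 0 < μ {h}} := by rw [hgen]; trivial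
  induction hmem using Subsemigroup.closure_induction with
  | mem h hh => exact norm_sub_permRep_le_of_pos μ hh
  | mul h k _ _ ih1 ih2 =>
    obtain ⟨C, hC, h1⟩ := ih1
    obtain ⟨D, hD, h2⟩ := ih2
    refine ⟨C + D, add_nonneg hC hD, fun φ => ?_⟩
    have h3 : φ - permRep (h * k) φ = (φ - permRep h φ) + permRep h (φ - permRep k φ) := by
      rw [permRep_mul, map_sub]
      abel
    rw [h3]
    refine (norm_add_le _ _).trans ?_
    rw [LinearIsometry.norm_map, add_mul]
    exact add_le_add (h1 φ) (h2 φ)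

open Classical in
theorem iterate_transitionOp_apply (s : X) (n : ℕ) (x : X) :
    ((transitionOp μ)^[n] (lp.single 2 s (1 : ℝ)) : lp (fun _ : X => ℝ) 2) x =
      (hitProb μ s n x).toReal := by
  induction n generalizing x with
  | zero =>
    by_cases hx : x = s
    · subst hx
      simp [hitProb_zero_self]
    · simp [hitProb_zero_of_ne μ hx, hx]
  | succ n ih =>
    rw [Function.iterate_succ_apply', transitionOp_apply, hitProb_succ]
    simp only [ih]
    exact integral_toReal (f := fun h => hitProb μ s n (h⁻¹ • x))
      Measurable.of_discrete.aemeasurable (ae_of_all _ fun h => measure_lt_top _ _)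

/-- The induced walk from `s` is transient if two group elements play ping-pong on a set meeting the
orbit of `s`. -/
theorem tsum_hitProb_self_lt_top_of_pingPong
    (hgen : Subsemigroup.closure {h : G | 0 < μ {h}} = ⊤)
    (J : Set X) (α β : G) (hα : ∀ x ∈ J, α • x ∈ J) (hβ : ∀ x ∈ J, β • x ∈ J)
    (hd : ∀ x ∈ J, ∀ y ∈ J, α • x ≠ β • y) (s : X) (k : G) (hk : k • s ∈ J) :
    ∑' n, hitProb μ s n s < ⊤ := by
  classical
  obtain ⟨C, hC, hCφ⟩ := abs_apply_le_of_pingPong J α β hα hβ hd hk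
  obtain ⟨C1, hC1, h1⟩ := norm_sub_permRep_le (X := X) μ hgen α⁻¹
  obtain ⟨C2, hC2, h2⟩ := norm_sub_permRep_le (X := X) μ hgen β⁻¹
  obtain ⟨C3, hC3, h3⟩ := norm_sub_permRep_le (X := X) μ hgen k⁻¹
  set K : ℝ := C * (C1 + C2) + C3 with hK
  -- The tree controls the value at `k • s`; the displacement under `k⁻¹` carries this back to `s`.
  have hbound : ∀ φ : lp (fun _ : X => ℝ) 2, |φ s| ≤ K * √(dirichletForm μ φ) := by
    intro φ
    set E := √(dirichletForm μ φ)
    have hE : 0 ≤ E := Real.sqrt_nonneg _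
    have h4 := hCφ φ ((C1 + C2) * E)
      ((h1 φ).trans (mul_le_mul_of_nonneg_right (by linarith) hE))
      ((h2 φ).trans (mul_le_mul_of_nonneg_right (by linarith) hE))
    have h5 : |(φ - permRep k⁻¹ φ) s| ≤ C3 * E :=
      (lp.norm_apply_le_norm (by norm_num) (φ - permRep k⁻¹ φ) s).trans (h3 φ)
    have h6 : (φ - permRep k⁻¹ φ) s = φ s - φ (k • s) := by
      rw [lp.coeFn_sub, Pi.sub_apply, permRep_apply, inv_inv]
    rw [h6] at h5
    have h7 := abs_sub_abs_le_abs_sub (φ s) (φ (k • s))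
    rw [hK]
    linarith
  have hK0 : 0 ≤ K := by positivity
  let u : ℕ → lp (fun _ : X => ℝ) 2 := fun n => (transitionOp μ)^[n] (lp.single 2 s (1 : ℝ))
  have hu : ∀ n x, u n x = (hitProb μ s n x).toReal := iterate_transitionOp_apply μ s
  let φ : ℕ → lp (fun _ : X => ℝ) 2 := fun N => ∑ n ∈ Finset.range N, u n
  have hφ : ∀ N x, φ N x = ∑ n ∈ Finset.range N, u n x := fun N x => by
    simp only [φ, lp.coeFn_sum, Finset.sum_apply]
  have htel : ∀ N, φ N - transitionOp μ (φ N) = lp.single 2 s (1 : ℝ) - u N := by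
    intro N
    induction N with
    | zero =>
      have : transitionOp μ (0 : lp (fun _ : X => ℝ) 2) = 0 := by simp [transitionOp]
      simp [φ, u, this]
    | succ N ih =>
      have h8 : φ (N + 1) = φ N + u N := Finset.sum_range_succ _ _
      have h9 : transitionOp μ (u N) = u (N + 1) :=
        (Function.iterate_succ_apply' (transitionOp μ) N _).symm
      rw [h8, transitionOp_add, h9, add_sub_add_comm, ih]
      abel
  -- The truncated Green function `φ N` has energy at most `φ N s`, since `φ N` and `u N` are
  -- nonnegative. With `hbound` this gives `φ N s ≤ K * √(φ N s)`.
  have hbd : ∀ N, φ N s ≤ K ^ 2 := by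
    intro N
    have h0 : 0 ≤ φ N s := by
      rw [hφ]
      exact Finset.sum_nonneg fun n _ => by rw [hu]; exact ENNReal.toReal_nonneg
    have hE : dirichletForm μ (φ N) ≤ φ N s := by
      rw [dirichletForm, htel, inner_sub_right, inner_single_one]
      have : 0 ≤ ⟪φ N, u N⟫_ℝ := by
        rw [lp.inner_eq_tsum]
        refine tsum_nonneg fun x => ?_
        refine mul_nonneg ?_ ?_
        · rw [hu]; exact ENNReal.toReal_nonneg
        · change 0 ≤ φ N x
          rw [hφ]
          exact Finset.sum_nonneg fun n _ => by rw [hu]; exact ENNReal.toReal_nonneg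
      linarith
    have h10 := hbound (φ N)
    rw [abs_of_nonneg h0] at h10
    have h11 : φ N s ≤ K * √(φ N s) :=
      h10.trans (mul_le_mul_of_nonneg_left (Real.sqrt_le_sqrt hE) hK0)
    have h12 := Real.mul_self_sqrt h0
    have h13 := Real.sqrt_nonneg (φ N s)
    nlinarith [sq_nonneg (√(φ N s) - K)]
  refine (ENNReal.tsum_le_of_sum_range_le (c := ENNReal.ofReal (K ^ 2)) fun N => ?_).trans_lt
    ENNReal.ofReal_lt_top
  have hfin : ∀ n, hitProb μ s n s ≠ ⊤ := fun n => measure_ne_top _ _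
  rw [← ENNReal.ofReal_toReal (ENNReal.sum_ne_top.2 fun n _ => hfin n)]
  refine ENNReal.ofReal_le_ofReal ?_
  rw [ENNReal.toReal_sum fun n _ => hfin n]
  have := hbd N
  rw [hφ] at this
  simpa only [hu] using this

end Transience

/-! ### Germs modulo PSL₂(ℤ) -/

section Germs

theorem mapGL_smul_coe_eq_coe {A : SL(2, ℤ)} {x y : ℝ}
    (h : (Matrix.SpecialLinearGroup.mapGL ℝ A) • (x : OnePoint ℝ) = (y : OnePoint ℝ)) :
    (A 1 0 : ℝ) * x + A 1 1 ≠ 0 ∧ (A 0 0 : ℝ) * x + A 0 1 = y * (A 1 0 * x + A 1 1) := by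
  rw [OnePoint.smul_some_eq_ite] at h
  simp only [Matrix.SpecialLinearGroup.mapGL_coe_matrix, Matrix.SpecialLinearGroup.map_apply_coe,
    RingHom.mapMatrix_apply, Matrix.map_apply, algebraMap_int_eq, eq_intCast] at h
  split_ifs at h with h0
  · exact absurd h (OnePoint.infty_ne_coe _)
  · refine ⟨h0, ?_⟩
    rw [OnePoint.coe_eq_coe, div_eq_iff h0] at h
    exact h

theorem det_coe_real (A : SL(2, ℤ)) : (A 0 0 : ℝ) * A 1 1 - A 0 1 * A 1 0 = 1 := by
  have := A.det_coe
  rw [Matrix.det_fin_two] at this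
  exact_mod_cast this

/-- An integer projective transformation that fixes an interval pointwise is the identity. -/
theorem mapGL_smul_eq_self_of_Ioo {A : SL(2, ℤ)} {u v : ℝ} (huv : u < v)
    (h : ∀ x ∈ Ioo u v,
      (Matrix.SpecialLinearGroup.mapGL ℝ A) • (x : OnePoint ℝ) = (x : OnePoint ℝ)) (x : ℝ) :
    (Matrix.SpecialLinearGroup.mapGL ℝ A) • (x : OnePoint ℝ) = (x : OnePoint ℝ) := by
  have hq : ∀ t : ℝ, t ∈ Ioo u v → (A 1 0 : ℝ) * t ^ 2 + (A 1 1 - A 0 0) * t - A 0 1 = 0 :=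
    fun t ht => by linarith [(mapGL_smul_coe_eq_coe (h t ht)).2]
  -- Three equally spaced zeros: the second difference of the quadratic kills its leading
  -- coefficient, then a first difference kills the linear one.
  have h1 := hq ((3 * u + v) / 4) ⟨by linarith, by linarith⟩
  have h2 := hq ((u + v) / 2) ⟨by linarith, by linarith⟩
  have h3 := hq ((u + 3 * v) / 4) ⟨by linarith, by linarith⟩
  have hne : (v - u) ^ 2 ≠ 0 := pow_ne_zero _ (by linarith)
  have hc : (A 1 0 : ℝ) = 0 := by
    have : (A 1 0 : ℝ) * (v - u) ^ 2 = 0 := by linear_combination 8 * h1 - 16 * h2 + 8 * h3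
    exact (mul_eq_zero.1 this).resolve_right hne
  have had : (A 1 1 - A 0 0 : ℝ) = 0 := by
    rw [hc] at h1 h2
    have : (A 1 1 - A 0 0 : ℝ) * (v - u) = 0 := by linear_combination 4 * h2 - 4 * h1
    exact (mul_eq_zero.1 this).resolve_right (by linarith)
  have hb : (A 0 1 : ℝ) = 0 := by
    rw [hc, had] at h1
    linarith
  have hd : (A 1 1 : ℝ) ≠ 0 := fun h0 => by
    have := det_coe_real A
    rw [h0, hc] at this
    simp at this
  rw [OnePoint.smul_some_eq_ite]
  simp only [Matrix.SpecialLinearGroup.mapGL_coe_matrix, Matrix.SpecialLinearGroup.map_apply_coe,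
    RingHom.mapMatrix_apply, Matrix.map_apply, algebraMap_int_eq, eq_intCast]
  rw [hc, hb, show (A 0 0 : ℝ) = A 1 1 by linarith]
  simp [hd]

/-- Two homeomorphisms of the line are related at `s` if near `s` they differ by
post-composition with an integer projective transformation. -/
def germSetoid (s : ℝ) : Setoid (ℝ ≃ₜ ℝ) where
  r h k := ∃ A : SL(2, ℤ), ∀ᶠ x in 𝓝 s, ((k x : ℝ) : OnePoint ℝ) =
    (Matrix.SpecialLinearGroup.mapGL ℝ A) • ((h x : ℝ) : OnePoint ℝ)
  iseqv :=
    { refl := fun _ => ⟨1, Eventually.of_forall fun _ => by simp⟩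
      symm := fun ⟨A, hA⟩ => ⟨A⁻¹, hA.mono fun x hx => by rw [hx, map_inv, inv_smul_smul]⟩
      trans := fun ⟨A, hA⟩ ⟨B, hB⟩ => ⟨B * A, by
        filter_upwards [hA, hB] with x hx hx'
        rw [hx', hx, map_mul, mul_smul]⟩ }

theorem germSetoid_mul_of_notMem_breakPoints {s : ℝ} {h k : ℝ ≃ₜ ℝ} (hs : h s ∉ breakPoints k) :
    (germSetoid s) h (k * h) := by
  obtain ⟨U, hU, A, hA⟩ := not_not.1 hs
  have hev : ∀ᶠ x in 𝓝 s, h x ∈ U := h.continuous.continuousAt.preimage_mem_nhds hU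
  exact ⟨A, hev.mono fun x hx => hA (h x) hx⟩

/-- A homeomorphism that is the identity to the left of `s` but not to the right of `s` changes
every germ class at `s`. -/
theorem not_germSetoid_mul {s ε : ℝ} (hε : 0 < ε) {g k : ℝ ≃ₜ ℝ}
    (hl : ∀ x ∈ Ioo (s - ε) s, g x = x) (hr : ∀ x ∈ Ioo s (s + ε), g x ≠ x) :
    ¬ (germSetoid s) k (k * g) := by
  rintro ⟨A, hA⟩
  obtain ⟨δ, hδ, hball⟩ := Metric.eventually_nhds_iff_ball.1 hA
  set ρ := min δ ε with hρ
  have hρ0 : 0 < ρ := lt_min hδ hε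
  have hAx : ∀ x ∈ Ioo (s - ρ) s,
      (Matrix.SpecialLinearGroup.mapGL ℝ A) • ((k x : ℝ) : OnePoint ℝ) = ((k x : ℝ) : OnePoint ℝ) :=
    fun x hx => by
      have h1 : x ∈ Metric.ball s δ := by
        rw [Real.ball_eq_Ioo]
        exact ⟨by linarith [hx.1, min_le_left δ ε], by linarith [hx.2]⟩
      have h2 := hball x h1
      rw [Homeomorph.mul_apply, hl x ⟨by linarith [hx.1, min_le_right δ ε], hx.2⟩] at h2
      exact h2.symm
  have himage : ∃ u v : ℝ, u < v ∧ Ioo u v ⊆ k '' Ioo (s - ρ) s := by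
    have ho : IsOpen (k '' Ioo (s - ρ) s) := k.isOpenMap _ isOpen_Ioo
    have hmem : k (s - ρ / 2) ∈ k '' Ioo (s - ρ) s :=
      mem_image_of_mem _ ⟨by linarith, by linarith⟩
    obtain ⟨η, hη, hsub⟩ := Metric.isOpen_iff.1 ho _ hmem
    rw [Real.ball_eq_Ioo] at hsub
    exact ⟨_, _, by linarith, hsub⟩
  obtain ⟨u, v, huv, hsub⟩ := himage
  -- `A` is trivial on an interval left of `k s`, hence everywhere; so `k * g = k` also just right
  -- of `s`, where `g` moves points.
  have hid := mapGL_smul_eq_self_of_Ioo (A := A) huv fun x hx => by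
    obtain ⟨y, hy, rfl⟩ := hsub hx
    exact hAx y hy
  have hx : s + ρ / 2 ∈ Metric.ball s δ := by
    rw [Real.ball_eq_Ioo]
    exact ⟨by linarith, by linarith [min_le_left δ ε]⟩
  have h3 := hball _ hx
  rw [hid, Homeomorph.mul_apply, OnePoint.coe_eq_coe] at h3
  exact hr _ ⟨by linarith, by linarith [min_le_right δ ε]⟩ (k.injective h3)

end Germs

/-! ### Piecewise projective homeomorphisms preserve orientation -/

section Monotone

/-- Beyond all exceptional points `g` is a single projective map of determinant 1 without a pole,
hence increasing there. -/
theorem strictMono_of_isPiecewisePSL2Z {g : ℝ ≃ₜ ℝ} (hg : IsPiecewisePSL2Z g) : StrictMono g := by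
  rcases g.continuous.strictMono_of_inj g.injective with h | h
  · exact h
  exfalso
  obtain ⟨F, hF, hgF⟩ := hg
  obtain ⟨M, hM⟩ := hF.bddAbove
  obtain ⟨A, hA⟩ := hgF (Ioi M) isPreconnected_Ioi (Set.disjoint_left.2 fun x hx hxF =>
    not_lt.2 (hM hxF) hx)
  have hne : ∀ x ∈ Ioi M, (A 1 0 : ℝ) * x + A 1 1 ≠ 0 := fun x hx =>
    (mapGL_smul_coe_eq_coe (hA x hx).symm).1
  have heq : ∀ x ∈ Ioi M, (A 0 0 : ℝ) * x + A 0 1 = g x * (A 1 0 * x + A 1 1) := fun x hx =>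
    (mapGL_smul_coe_eq_coe (hA x hx).symm).2
  have h1 : M + 1 ∈ Ioi M := by simp
  have h2 : M + 2 ∈ Ioi M := by simp
  -- The denominator does not vanish on the ray, so it keeps its sign.
  have hpos : 0 < ((A 1 0 : ℝ) * (M + 1) + A 1 1) * (A 1 0 * (M + 2) + A 1 1) := by
    by_contra hle
    have hc : ContinuousOn (fun x : ℝ => (A 1 0 : ℝ) * x + A 1 1) (Ioi M) := by fun_prop
    have himg := isPreconnected_Ioi.image _ hc
    have h0 : (0 : ℝ) ∈ (fun x : ℝ => (A 1 0 : ℝ) * x + A 1 1) '' Ioi M := by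
      rcases mul_nonpos_iff.1 (not_lt.1 hle) with ⟨ha, hb⟩ | ⟨ha, hb⟩
      · exact himg.ordConnected.out (mem_image_of_mem _ h2) (mem_image_of_mem _ h1) ⟨hb, ha⟩
      · exact himg.ordConnected.out (mem_image_of_mem _ h1) (mem_image_of_mem _ h2) ⟨ha, hb⟩
    obtain ⟨x, hx, hx0⟩ := h0
    exact hne x hx hx0
  have hlt : g (M + 2) < g (M + 1) := h (by linarith)
  have e1 := heq _ h1
  have e2 := heq _ h2
  have hdet := det_coe_real A
  have : (g (M + 2) - g (M + 1)) * (((A 1 0 : ℝ) * (M + 1) + A 1 1) * (A 1 0 * (M + 2) + A 1 1)) =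
      1 := by
    linear_combination (A 1 0 * (M + 2) + A 1 1 : ℝ) * e1 - (A 1 0 * (M + 1) + A 1 1 : ℝ) * e2 + hdet
  nlinarith

end Monotone

/-! ### Dynamics of increasing homeomorphisms -/

section PingPong

/-- If an increasing homeomorphism moves every point of `(b, c]` to the left and fixes `b`, then its
iterates push `c` to `b`. -/
theorem exists_pow_apply_lt {g : ℝ ≃ₜ ℝ} {b c d : ℝ} (hbc : b < c) (hmono : StrictMono g)
    (hgb : g b = b) (hlt : ∀ x ∈ Ioc b c, g x < x) (hbd : b < d) : ∃ n : ℕ, (g ^ n) c < d := by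
  by_contra! hcon
  have hsucc : ∀ n : ℕ, (g ^ (n + 1)) c = g ((g ^ n) c) := fun n => by
    rw [pow_succ', Homeomorph.mul_apply]
  have hmem : ∀ n : ℕ, (g ^ n) c ∈ Ioc b c := by
    intro n
    induction n with
    | zero => exact ⟨hbc, le_rfl⟩
    | succ n ih =>
      rw [hsucc]
      exact ⟨hgb ▸ hmono ih.1, (hlt _ ih).le.trans ih.2⟩
  have hanti : Antitone fun n : ℕ => (g ^ n) c := antitone_nat_of_succ_le fun n => by
    rw [hsucc]
    exact (hlt _ (hmem n)).le
  have hlim := tendsto_atTop_ciInf hanti ⟨b, by rintro _ ⟨n, rfl⟩; exact (hmem n).1.le⟩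
  -- By continuity this limit is a fixed point, and it would lie in `(b, c]`.
  set L := ⨅ n : ℕ, (g ^ n) c
  have hL : L ∈ Ioc b c :=
    ⟨hbd.trans_le (ge_of_tendsto' hlim hcon), le_of_tendsto' hlim fun n => (hmem n).2⟩
  have h1 : Tendsto (fun n : ℕ => (g ^ (n + 1)) c) atTop (𝓝 (g L)) := by
    simp only [hsucc]
    exact (g.continuous.tendsto L).comp hlim
  have h2 := tendsto_nhds_unique h1 (hlim.comp (tendsto_add_atTop_nat 1))
  exact (hlt L hL).ne h2

/-- A homeomorphism without fixed points in a preconnected set moves all its points in the same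
direction. -/
theorem forall_lt_or_forall_gt {g : ℝ ≃ₜ ℝ} {s : Set ℝ}
    (hs : IsPreconnected s) (hne : s ⊆ homeoSupp g) :
    (∀ x ∈ s, g x < x) ∨ (∀ x ∈ s, x < g x) := by
  by_contra! hcon
  obtain ⟨⟨x, hx, hxg⟩, y, hy, hyg⟩ := hcon
  have hc : ContinuousOn (fun t => g t - t) s := by fun_prop
  obtain ⟨t, ht, ht0⟩ := (hs.image _ hc).ordConnected.out (mem_image_of_mem _ hy)
    (mem_image_of_mem _ hx) (show (0 : ℝ) ∈ _ from ⟨by linarith, by linarith⟩)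
  exact hne ht (sub_eq_zero.1 ht0)

end PingPong

/-! ### Ping-pong on `[b, c]` inside the subgroup -/

section PingPongSubgroup

theorem exists_mem_forall_apply_lt {H : Subgroup (ℝ ≃ₜ ℝ)} (hmono : ∀ h ∈ H, StrictMono h)
    {g : ℝ ≃ₜ ℝ} (hg : g ∈ H) {s : Set ℝ} (hs : IsPreconnected s) (hne : s ⊆ homeoSupp g) :
    ∃ k ∈ H, (∀ x, g x = x → k x = x) ∧ ∀ x ∈ s, k x < x := by
  rcases forall_lt_or_forall_gt hs hne with h | h
  · exact ⟨g, hg, fun _ hx => hx, h⟩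
  · refine ⟨g⁻¹, H.inv_mem hg, fun x hx => g.symm_apply_eq.2 hx.symm, fun x hx => ?_⟩
    rw [← (hmono g hg).lt_iff_lt]
    exact (g.apply_symm_apply x).trans_lt (h x hx)

theorem exists_mem_forall_lt_apply {H : Subgroup (ℝ ≃ₜ ℝ)} (hmono : ∀ h ∈ H, StrictMono h)
    {g : ℝ ≃ₜ ℝ} (hg : g ∈ H) {s : Set ℝ} (hs : IsPreconnected s) (hne : s ⊆ homeoSupp g) :
    ∃ k ∈ H, (∀ x, g x = x → k x = x) ∧ ∀ x ∈ s, x < k x := by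
  rcases forall_lt_or_forall_gt hs hne with h | h
  · refine ⟨g⁻¹, H.inv_mem hg, fun x hx => g.symm_apply_eq.2 hx.symm, fun x hx => ?_⟩
    rw [← (hmono g hg).lt_iff_lt]
    exact (h x hx).trans_eq (g.apply_symm_apply x).symm
  · exact ⟨g, hg, fun _ hx => hx, h⟩

/-- Up to inversion `f` pushes `[b, c]` into `[α b, c]` with `b < α b`, and a high power of `g` or
its inverse squeezes `[b, c]` into `[b, α b)`. -/
theorem exists_pingPong_Icc {H : Subgroup (ℝ ≃ₜ ℝ)} (hmono : ∀ h ∈ H, StrictMono h)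
    {f g : ℝ ≃ₜ ℝ} (hf : f ∈ H) (hg : g ∈ H) {b c : ℝ} (hbc : b < c) (hgb : g b = b)
    (hfc : f c = c) (hgsupp : Ioc b c ⊆ homeoSupp g) (hfsupp : Ico b c ⊆ homeoSupp f) :
    ∃ α ∈ H, ∃ β ∈ H, (∀ x ∈ Icc b c, α x ∈ Icc b c) ∧ (∀ x ∈ Icc b c, β x ∈ Icc b c) ∧
      ∀ x ∈ Icc b c, ∀ y ∈ Icc b c, α x ≠ β y := by
  obtain ⟨α, hα, hαfix, hαlt⟩ := exists_mem_forall_lt_apply hmono hf isPreconnected_Ico hfsupp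
  obtain ⟨γ, hγ, hγfix, hγlt⟩ := exists_mem_forall_apply_lt hmono hg isPreconnected_Ioc hgsupp
  have hb : b < α b := hαlt b ⟨le_rfl, hbc⟩
  obtain ⟨n, hn⟩ := exists_pow_apply_lt hbc (hmono γ hγ) (hγfix b hgb) hγlt hb
  have hβ : γ ^ n ∈ H := H.pow_mem hγ n
  have hβb : (γ ^ n) b = b := by
    clear hn hβ
    induction n with
    | zero => rfl
    | succ n ih => rw [pow_succ', Homeomorph.mul_apply, ih, hγfix b hgb]
  have hαx : ∀ x ∈ Icc b c, α b ≤ α x ∧ α x ≤ c := fun x hx =>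
    ⟨(hmono α hα).monotone hx.1, ((hmono α hα).monotone hx.2).trans_eq (hαfix c hfc)⟩
  have hβx : ∀ x ∈ Icc b c, b ≤ (γ ^ n) x ∧ (γ ^ n) x < α b := fun x hx =>
    ⟨hβb.symm.trans_le ((hmono _ hβ).monotone hx.1), ((hmono _ hβ).monotone hx.2).trans_lt hn⟩
  have hαb : α b ≤ c := (hαx b ⟨le_rfl, hbc.le⟩).2
  exact ⟨α, hα, γ ^ n, hβ, fun x hx => ⟨hb.le.trans (hαx x hx).1, (hαx x hx).2⟩,
    fun x hx => ⟨(hβx x hx).1, (hβx x hx).2.le.trans hαb⟩,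
    fun x hx y hy => ((hβx y hy).2.trans_le (hαx x hx).1).ne'⟩

end PingPongSubgroup

/-! ### Shift-invariant events and the Poisson boundary -/

section Boundary

theorem countable_of_subsemigroup_closure_eq_top {G : Type*} [Monoid G] {S : Set G}
    (hS : S.Countable) (h : Subsemigroup.closure S = ⊤) : Countable G := by
  have := hS.to_subtype
  refine Function.Surjective.countable (f := fun l : List S => (l.map Subtype.val).prod) fun x => ?_
  have hx : x ∈ Subsemigroup.closure S := by rw [h]; trivial
  induction hx using Subsemigroup.closure_induction with
  | mem x hx => exact ⟨[⟨x, hx⟩], by simp⟩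
  | mul x y _ _ ih1 ih2 =>
    obtain ⟨l, rfl⟩ := ih1
    obtain ⟨m, rfl⟩ := ih2
    exact ⟨l ++ m, by simp⟩

theorem countable_setOf_measure_singleton_pos {α : Type*} [MeasurableSpace α]
    [MeasurableSingletonClass α] (μ : Measure α) [IsFiniteMeasure μ] :
    {a : α | 0 < μ {a}}.Countable :=
  Measure.countable_meas_pos_of_disjoint_iUnion (fun a => measurableSet_singleton a)
    fun _ _ hab => disjoint_singleton.2 hab

theorem measurableSet_eventually_eq {G Q : Type*} [MeasurableSpace G]
    [DiscreteMeasurableSpace G] (D : G → Q) (q : Q) :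
    MeasurableSet {x : ℕ → G | ∀ᶠ n in atTop, D (x n) = q} := by
  have : {x : ℕ → G | ∀ᶠ n in atTop, D (x n) = q} =
      ⋃ N : ℕ, ⋂ n : ℕ, ⋂ _ : N ≤ n, {x | D (x n) = q} := by
    ext x
    simp [eventually_atTop]
  rw [this]
  have hm : ∀ n, Measurable fun x : ℕ → G => x n := measurable_pi_apply
  exact MeasurableSet.iUnion fun N => MeasurableSet.iInter fun n => MeasurableSet.iInter fun _ =>
    hm n (MeasurableSet.of_discrete (s := {k | D k = q}))

variable {G : Type*} [Group G] [MeasurableSpace G] (μ : Measure G) [IsProbabilityMeasure μ]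

/-- A first increment `g` of positive mass turns `x_{n+1}` into `x_n * g`, with `x_n` a fresh walk.
An almost sure property survives conditioning on it; general `g` is a product of such increments. -/
theorem ae_eventually_mul_right_eq (hgen : Subsemigroup.closure {h : G | 0 < μ {h}} = ⊤)
    {Q : Type*} {D : G → Q} {q : Q} (hq : ∀ᵐ y ∂(Measure.infinitePi fun _ : ℕ => μ),
      ∀ᶠ n in atTop, D (walkTrajectory y n) = q) (g : G) :
    ∀ᵐ y ∂(Measure.infinitePi fun _ : ℕ => μ), ∀ᶠ n in atTop, D (walkTrajectory y n * g) = q := by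
  let full : G → Prop := fun k =>
    ∀ᵐ y ∂(Measure.infinitePi fun _ : ℕ => μ), ∀ᶠ n in atTop, D (walkTrajectory y n * k) = q
  have key : ∀ k, full k → full (g * k) := by
    have hmem : g ∈ Subsemigroup.closure {h : G | 0 < μ {h}} := by rw [hgen]; trivial
    induction hmem using Subsemigroup.closure_induction with
    | mem g hg =>
      intro k hk
      have h1 := ae_infinitePi_seqCons μ hk
      rw [ae_iff] at h1
      have h2 : ∀ᵐ y ∂(Measure.infinitePi fun _ : ℕ => μ), ∀ᶠ n in atTop,
          D (walkTrajectory (seqCons (g, y)) n * k) = q := by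
        by_contra hcon
        exact hg.ne' (measure_mono_null (singleton_subset_iff.2 hcon) h1)
      filter_upwards [h2] with y hy
      filter_upwards [(tendsto_add_atTop_nat 1).eventually hy] with n hn
      rwa [walkTrajectory_seqCons, mul_assoc] at hn
    | mul g h _ _ ih1 ih2 =>
      intro k hk
      rw [mul_assoc]
      exact ih1 _ (ih2 k hk)
  have h1 : full 1 := by simpa only [full, mul_one] using hq
  simpa only [full, mul_one] using key 1 h1

variable [Countable G] [DiscreteMeasurableSpace G]

/-- If a function of the position of the walk almost surely stabilizes, then the Poisson boundary is
non-trivial unless the limit value is almost surely the same constant. -/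
theorem nontrivialPoissonBoundary_or_ae_eventually_eq {Q : Type*} (D : G → Q)
    (hD : ∀ᵐ y ∂(Measure.infinitePi fun _ : ℕ => μ), ∀ᶠ n in atTop,
      D (walkTrajectory y (n + 1)) = D (walkTrajectory y n)) :
    NontrivialPoissonBoundary μ ∨ ∃ q, ∀ᵐ y ∂(Measure.infinitePi fun _ : ℕ => μ),
      ∀ᶠ n in atTop, D (walkTrajectory y n) = q := by
  set P := Measure.infinitePi fun _ : ℕ => μ with hP
  let E : G → Set (ℕ → G) := fun h => {x | ∀ᶠ n in atTop, D (x n) = D h}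
  have hcover : ∀ᵐ y ∂P, ∃ h : G, walkTrajectory y ∈ E h := by
    filter_upwards [hD] with y hy
    obtain ⟨N, hN⟩ := eventually_atTop.1 hy
    refine ⟨walkTrajectory y N, eventually_atTop.2 ⟨N, fun n hn => ?_⟩⟩
    induction n, hn using Nat.le_induction with
    | base => rfl
    | succ n hn ih => rw [hN n hn, ih]
  -- `G` is countable, so the events `E h` cannot all be null.
  obtain ⟨h, hh⟩ : ∃ h : G, P {y | walkTrajectory y ∈ E h} ≠ 0 := by
    by_contra! hcon
    have h1 : ∀ᵐ y ∂P, ∀ h : G, walkTrajectory y ∉ E h := ae_all_iff.2 fun h => by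
      rw [ae_iff]
      simpa using hcon h
    obtain ⟨y, ⟨k, hk⟩, hy⟩ := (hcover.and h1).exists
    exact hy k hk
  have hEm : MeasurableSet (E h) := measurableSet_eventually_eq D (D h)
  have hEinv : ∀ x y : ℕ → G, (trajectorySetoid G) x y → x ∈ E h → y ∈ E h := by
    rintro x y ⟨m, n, hmn⟩ hx
    obtain ⟨N, hN⟩ := eventually_atTop.1 hx
    refine eventually_atTop.2 ⟨n + N, fun i hi => ?_⟩
    have h2 := hmn (i - n)
    rw [Nat.add_sub_cancel' (by omega)] at h2
    rw [← h2]
    exact hN _ (by omega)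
  let B : Set (PoissonBoundary G) := Quotient.mk (trajectorySetoid G) '' E h
  have hpre : Quotient.mk (trajectorySetoid G) ⁻¹' B = E h := by
    ext x
    constructor
    · rintro ⟨y, hy, hxy⟩
      exact hEinv y x (Quotient.exact hxy) hy
    · exact fun hx => ⟨x, hx, rfl⟩
  have hB : MeasurableSet B := measurableSet_quotient.2 (hpre ▸ hEm)
  have hval : poissonMeasure μ B = P {y | walkTrajectory y ∈ E h} := by
    rw [poissonMeasure, Measure.map_apply measurable_quotient_mk'' hB]
    exact (congrArg _ hpre).trans (Measure.map_apply measurable_walkTrajectory hEm)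
  by_cases h1 : P {y | walkTrajectory y ∈ E h} < 1
  · exact Or.inl ⟨B, hB, hval ▸ pos_iff_ne_zero.2 hh, hval ▸ h1⟩
  · refine Or.inr ⟨D h, ?_⟩
    have h2 := le_antisymm prob_le_one (not_lt.1 h1)
    exact (mem_ae_iff_prob_eq_one (measurable_walkTrajectory hEm)).2 h2

end Boundary

/-! ### Conclusion: the limit germ at `s` -/

/-- The action of the homeomorphism group on the space. -/
instance homeomorphMulAction {X : Type*} [TopologicalSpace X] : MulAction (X ≃ₜ X) X where
  smul g x := g x
  one_smul _ := rfl
  mul_smul _ _ _ := rfl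

theorem lemma6p3 (H : Subgroup (ℝ ≃ₜ ℝ)) (hH : H ≤ piecewisePSL2Z)
    (f g : ℝ ≃ₜ ℝ) (hf : f ∈ H) (hg : g ∈ H)
    (b c : ℝ) (hbc : b < c) (hgb : g b = b) (hfc : f c = c)
    (hgsupp : Set.Ioc b c ⊆ homeoSupp g) (hfsupp : Set.Ico b c ⊆ homeoSupp f)
    (s : ℝ) (hs : s ∈ hyperbolicFixedPoints ∪ Set.range ((↑) : ℚ → ℝ)) (hsb : s ≤ b)
    (hfs : ∃ n : ℤ, (f ^ n) s ∈ Set.Icc b c)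
    (hgs : ∃ ε₀ : ℝ, 0 < ε₀ ∧
      ∀ ε : ℝ, 0 < ε → ε ≤ ε₀ → g (s - ε) = s - ε ∧ g (s + ε) ≠ s + ε)
    [MeasurableSpace H] [DiscreteMeasurableSpace H]
    (μ : MeasureTheory.Measure H) [MeasureTheory.IsProbabilityMeasure μ]
    (hBr : ∫⁻ h : H, numBreaks (h : ℝ ≃ₜ ℝ) ∂μ < ⊤)
    (hgen : Subsemigroup.closure {h : H | 0 < μ {h}} = ⊤) :
    NontrivialPoissonBoundary μ := by
  have : Countable H :=
    countable_of_subsemigroup_closure_eq_top (countable_setOf_measure_singleton_pos μ) hgen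
  have hmono : ∀ h ∈ H, StrictMono h := fun h hh => strictMono_of_isPiecewisePSL2Z (hH hh)
  obtain ⟨α, hα, β, hβ, hαJ, hβJ, hd⟩ :=
    exists_pingPong_Icc hmono hf hg hbc hgb hfc hgsupp hfsupp
  obtain ⟨n, hn⟩ := hfs
  -- The line is used here as a discrete `H`-set.
  have htr : ∑' n, hitProb μ s n s < ⊤ :=
    tsum_hitProb_self_lt_top_of_pingPong μ hgen (Icc b c) ⟨α, hα⟩ ⟨β, hβ⟩ hαJ hβJ hd s
      ⟨f ^ n, H.zpow_mem hf n⟩ hn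
  have hstab := ae_eventually_walk_smul_notMem μ s htr (fun h : H => breakPoints (h : ℝ ≃ₜ ℝ)) hBr
  let D : H → Quotient (germSetoid s) := fun h => Quotient.mk _ (h : ℝ ≃ₜ ℝ)
  have hD : ∀ᵐ y ∂(Measure.infinitePi fun _ : ℕ => μ), ∀ᶠ n in atTop,
      D (walkTrajectory y (n + 1)) = D (walkTrajectory y n) :=
    hstab.mono fun y hy => hy.mono fun n hn =>
      (Quotient.sound (germSetoid_mul_of_notMem_breakPoints hn)).symm
  refine (nontrivialPoissonBoundary_or_ae_eventually_eq μ D hD).resolve_right ?_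
  rintro ⟨q, hq⟩
  -- On one trajectory, at one large time, `x_n` and `x_n g` would both have class `q`.
  obtain ⟨y, h1, h2⟩ := (hq.and (ae_eventually_mul_right_eq μ hgen hq ⟨g, hg⟩)).exists
  obtain ⟨n, h3, h4⟩ := (h1.and h2).exists
  obtain ⟨ε, hε, hgε⟩ := hgs
  refine not_germSetoid_mul hε (g := g) (k := (walkTrajectory y n : H)) (fun x hx => ?_)
    (fun x hx => ?_) (Quotient.exact (h3.trans h4.symm))
  · have := (hgε (s - x) (by linarith [hx.2]) (by linarith [hx.1])).1
    rwa [sub_sub_cancel] at this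
  · have := (hgε (x - s) (by linarith [hx.1]) (by linarith [hx.2])).2
    rwa [add_sub_cancel] at this
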